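/- Let $(R,\mathfrak m,K)$ be a regular local ring of prime characteristic $p>0$ and dimension $d\ge 1$. Let $F$ denote the Frobenius functor on $R$-modules: $F(M)$ is the base change $R^{(1)}\otimes_R M$ along the Frobenius map $R\to R^{(1)}=R$, regarded as an $R$-module through $R^{(1)}=R$. An $F_R$-module is an $R$-module $M$ with an $R$-linear isomorphism $\theta_M\colon M\to F(M)$; a homomorphism of $F_R$-modules is an $R$-linear map $f\colon M\to M'$ with $F(f)\circ\theta_M=\theta_{M'}\circ f$. For an $F_R$-module $M$ and $x\in M$ write $x^p:=\theta_M^{-1}(1\otimes x)$, and let $G_M=\{x^p-x : x\in M\}$, a subgroup of $M$. Give $R$ its standard $F_R$-module structure $R\cong F(R)$, $1\mapsto 1\otimes 1$. Let $x_1,\dots,x_d$ be generators of $\mathfrak m$, and let $E=E(R/\mathfrak m)$ be the injective hull of the residue field with its standard $F_R$-module structure: $E$ is the direct limit of $$R/\mathfrak m\xrightarrow{\ \beta\ }F(R/\mathfrak m)\xrightarrow{F(\beta)}F^2(R/\mathfrak m)\xrightarrow{F^2(\beta)}\cdots,$$ where $\beta(1)=x_1^{p-1}\cdots x_d^{p-1}\otimes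 1$, and $\theta_E\colon E\to F(E)$ is induced by the maps $F^e(\beta)\colon F^e(R/\mathfrak m)\to F(F^e(R/\mathfrak m))$. Let $\operatorname{Ext}^1_{F_R}(R,E)$ be the set of equivalence classes of extensions $0\to E\to L\to R\to 0$ of $F_R$-modules, whose zero element is the class of the split extension. Then: 1. any two distinct elements of the socle $\{u\in E : \mathfrak m u=0\}$ have distinct images in $E/G_E$; 2. $\operatorname{Ext}^1_{F_R}(R,E)\neq 0$; 3. if $K$ is infinite, then $\operatorname{Ext}^1_{F_R}(R,E)$ is infinite; 4. $E$ is not an injective object of the category of $F_R$-modules. -/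

import Mathlib

open CategoryTheory IsLocalRing

open scoped ChangeOfRings

universe u

noncomputable section

/-- The target ring `R^{(1)}` of the Frobenius map `R → R`, as a copy of the ring `R`. -/
def FrobRing (R : Type u) : Type u := R

instance (R : Type u) [CommRing R] : CommRing (FrobRing R) := inferInstanceAs (CommRing R)

/-- The identification of `R` with `R^{(1)}`. -/
def toFrobRing (R : Type u) [CommRing R] : R ≃+* FrobRing R := RingEquiv.refl R

/-- The Frobenius map `R → R^{(1)}`, `r ↦ r ^ p`. -/
def frobMap (R : Type u) [CommRing R] (p : ℕ) [ExpChar R p] : R →+* FrobRing R :=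
  (toFrobRing R).toRingHom.comp (frobenius R p)

/-- The Peskine–Szpiro Frobenius functor `F` on `R`-modules: base change along the Frobenius map
`R → R^{(1)}`, followed by the identification of `R^{(1)}` with `R`. -/
def frobeniusFunctor (R : Type u) [CommRing R] (p : ℕ) [ExpChar R p] :
    ModuleCat.{u} R ⥤ ModuleCat.{u} R :=
  ModuleCat.extendScalars (frobMap R p) ⋙ ModuleCat.restrictScalars (toFrobRing R).toRingHom

instance (R : Type u) [CommRing R] (p : ℕ) [ExpChar R p] : (frobeniusFunctor R p).Additive :=
  have : (ModuleCat.extendScalars.{u, u, u} (frobMap R p)).Additive :=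
    (ModuleCat.extendRestrictScalarsAdj (frobMap R p)).left_adjoint_additive
  inferInstanceAs (ModuleCat.extendScalars (frobMap R p) ⋙
    ModuleCat.restrictScalars (toFrobRing R).toRingHom).Additive

instance (R : Type u) [CommRing R] (p : ℕ) [ExpChar R p] :
    Limits.PreservesBinaryBiproducts (frobeniusFunctor R p) :=
  Limits.preservesBinaryBiproducts_of_preservesBiproducts _

/-- The element `r ⊗ x` of `F(M)`. -/
def frobTmul {R : Type u} [CommRing R] (p : ℕ) [ExpChar R p] {M : ModuleCat.{u} R}
    (r : R) (x : M) : (frobeniusFunctor R p).obj M :=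
  (toFrobRing R r ⊗ₜ[R, frobMap R p] x :)

section frobTmul

variable {R : Type u} [CommRing R] (p : ℕ) [ExpChar R p] {M N : ModuleCat.{u} R}

theorem frobTmul_add (r : R) (x y : M) :
    frobTmul p r (x + y) = frobTmul p r x + frobTmul p r y :=
  letI := Module.compHom (FrobRing R) (frobMap R p)
  TensorProduct.tmul_add (R := R) (toFrobRing R r) x y

theorem add_frobTmul (r s : R) (x : M) :
    frobTmul p (r + s) x = frobTmul p r x + frobTmul p s x :=
  letI := Module.compHom (FrobRing R) (frobMap R p)
  TensorProduct.add_tmul (R := R) (toFrobRing R r) (toFrobRing R s) x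

theorem frobTmul_zero (r : R) : frobTmul p r (0 : M) = 0 :=
  letI := Module.compHom (FrobRing R) (frobMap R p)
  TensorProduct.tmul_zero (R := R) M (toFrobRing R r)

theorem smul_frobTmul (s r : R) (x : M) : s • frobTmul p r x = frobTmul p (s * r) x :=
  rfl

theorem frobTmul_smul (r s : R) (x : M) : frobTmul p r (s • x) = frobTmul p (s ^ p * r) x :=
  letI := Module.compHom (FrobRing R) (frobMap R p)
  (TensorProduct.smul_tmul (R := R) s (toFrobRing R r) x).symm

theorem map_frobTmul (g : M ⟶ N) (r : R) (x : M) :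
    (frobeniusFunctor R p).map g (frobTmul p r x) = frobTmul p r (g x) :=
  rfl

end frobTmul

/-- An `F_R`-module: an `R`-module with an `R`-linear isomorphism `θ : M → F(M)`. -/
structure FRModule (R : Type u) [CommRing R] (p : ℕ) [ExpChar R p] where
  /-- the underlying `R`-module -/
  carrier : ModuleCat.{u} R
  /-- the structure isomorphism `θ` -/
  str : carrier ≅ (frobeniusFunctor R p).obj carrier

namespace FRModule

variable {R : Type u} [CommRing R] {p : ℕ} [ExpChar R p]

/-- A homomorphism of `F_R`-modules: an `R`-linear map commuting with the structure morphisms. -/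
@[ext]
structure Hom (M N : FRModule R p) where
  /-- the underlying `R`-linear map -/
  hom : M.carrier ⟶ N.carrier
  comm : M.str.hom ≫ (frobeniusFunctor R p).map hom = hom ≫ N.str.hom

instance : Category (FRModule R p) where
  Hom M N := Hom M N
  id M := ⟨𝟙 _, by simp⟩
  comp f g := ⟨f.hom ≫ g.hom, by
    rw [Functor.map_comp, ← Category.assoc, f.comm, Category.assoc, g.comm, Category.assoc]⟩
  id_comp f := Hom.ext (Category.id_comp f.hom)
  comp_id f := Hom.ext (Category.comp_id f.hom)
  assoc f g h := Hom.ext (Category.assoc f.hom g.hom h.hom)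

@[ext]
theorem hom_ext {M N : FRModule R p} {f g : M ⟶ N} (h : f.hom = g.hom) : f = g :=
  Hom.ext h

@[simp]
theorem id_hom (M : FRModule R p) : (𝟙 M : M ⟶ M).hom = 𝟙 M.carrier := rfl

@[simp]
theorem comp_hom {M N L : FRModule R p} (f : M ⟶ N) (g : N ⟶ L) :
    (f ≫ g).hom = f.hom ≫ g.hom := rfl

/-- The additive map `x ↦ x^p := θ⁻¹(1 ⊗ x)` on an `F_R`-module. -/
def frob (M : FRModule R p) : M.carrier →+ M.carrier :=
  AddMonoidHom.mk' (fun x => M.str.inv (frobTmul p 1 x)) fun x y => by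
    rw [frobTmul_add, map_add]

/-- The subgroup `G_M = {x^p - x | x ∈ M}`. -/
def G (M : FRModule R p) : AddSubgroup M.carrier :=
  (M.frob - AddMonoidHom.id M.carrier).range

variable (R p) in
/-- `R` with its standard `F_R`-module structure `R ≅ F(R)`, sending `1` to `1 ⊗ 1`. -/
def ring : FRModule R p where
  carrier := ModuleCat.of R R
  str :=
    letI : Algebra R (FrobRing R) := (frobMap R p).toAlgebra
    let e : FrobRing R ≃ₗ[FrobRing R] TensorProduct R (FrobRing R) R :=
      (TensorProduct.AlgebraTensorModule.rid R (FrobRing R) (FrobRing R)).symm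
    LinearEquiv.toModuleIso (X₁ := R) (X₂ := (frobeniusFunctor R p).obj (ModuleCat.of R R))
      (m₁ := inferInstance) (m₂ := ((frobeniusFunctor R p).obj (ModuleCat.of R R)).isModule)
      { toFun := e, invFun := e.symm, left_inv := e.left_inv, right_inv := e.right_inv,
        map_add' := e.map_add, map_smul' := e.map_smul }

theorem ring_str_apply (r : R) : (ring R p).str.hom r = frobTmul p r (1 : R) := rfl

open Limits in
/-- The direct sum of two `F_R`-modules: the direct sum of the underlying modules, with the direct
sum of the structure isomorphisms, as `F` commutes with direct sums. -/
def biprod (M N : FRModule R p) : FRModule R p where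
  carrier := M.carrier ⊞ N.carrier
  str := biprod.mapIso M.str N.str ≪≫ ((frobeniusFunctor R p).mapBiprod M.carrier N.carrier).symm

open Limits in
/-- The inclusion `M → M ⊕ N`. -/
def biprodInl (M N : FRModule R p) : M ⟶ biprod M N :=
  Hom.mk Limits.biprod.inl (by
    change M.str.hom ≫ _ = Limits.biprod.inl ≫ Limits.biprod.map _ _ ≫
      ((frobeniusFunctor R p).mapBiprod M.carrier N.carrier).inv
    rw [Functor.mapBiprod_inv, Limits.biprod.inl_map_assoc]
    exact congrArg (M.str.hom ≫ ·) (Limits.biprod.inl_desc _ _).symm)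

open Limits in
/-- The projection `M ⊕ N → N`. -/
def biprodSnd (M N : FRModule R p) : biprod M N ⟶ N :=
  Hom.mk Limits.biprod.snd (by
    change (Limits.biprod.map _ _ ≫
      ((frobeniusFunctor R p).mapBiprod M.carrier N.carrier).inv) ≫
      (frobeniusFunctor R p).map (Limits.biprod.snd : M.carrier ⊞ N.carrier ⟶ N.carrier) =
      (Limits.biprod.snd : M.carrier ⊞ N.carrier ⟶ N.carrier) ≫ N.str.hom
    rw [← Limits.biprod.map_snd M.str.hom, Category.assoc]
    refine congrArg (Limits.biprod.map _ _ ≫ ·) ?_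
    rw [Iso.inv_comp_eq, Functor.mapBiprod_hom]
    exact (Limits.biprod.lift_snd _ _).symm)

/-- An extension of `N` by `M`: a short exact sequence `0 → M → L → N → 0` of `F_R`-modules, that is,
homomorphisms of `F_R`-modules that form a short exact sequence of `R`-modules. (For regular `R` the
functor `F` is exact, so kernels and cokernels of `F_R`-modules are those of `R`-modules.) -/
structure Extension (N M : FRModule R p) where
  /-- the middle term -/
  L : FRModule R p
  /-- the map `M → L` -/
  i : M ⟶ L
  /-- the map `L → N` -/
  q : L ⟶ N
  injective : Function.Injective i.hom
  exact : Function.Exact i.hom q.hom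
  surjective : Function.Surjective q.hom

namespace Extension

variable {M N : FRModule R p}

/-- Two extensions of `N` by `M` are equivalent if their middle terms are isomorphic as
`F_R`-modules by an isomorphism that induces the identity on `M` and on `N`. -/
instance setoid (N M : FRModule R p) : Setoid (Extension N M) where
  r ξ η := ∃ g : ξ.L ≅ η.L, ξ.i ≫ g.hom = η.i ∧ g.hom ≫ η.q = ξ.q
  iseqv :=
    { refl := fun ξ => ⟨Iso.refl _, by simp, by simp⟩
      symm := fun ⟨g, h₁, h₂⟩ => ⟨g.symm, by simp [← h₁], by simp [← h₂]⟩
      trans := fun ⟨g, h₁, h₂⟩ ⟨g', h₁', h₂'⟩ =>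
        ⟨g ≪≫ g', by simp [← h₁', ← h₁], by simp [← h₂, ← h₂']⟩ }

/-- The split extension `0 → M → M ⊕ N → N → 0`. -/
def split (N M : FRModule R p) : Extension N M where
  L := biprod M N
  i := biprodInl M N
  q := biprodSnd M N
  injective := (ModuleCat.mono_iff_injective _).1
    (inferInstanceAs (Mono (Limits.biprod.inl : M.carrier ⟶ M.carrier ⊞ N.carrier)))
  exact := fun y => by
    have h := ConcreteCategory.congr_hom (Limits.biprod.total (X := M.carrier) (Y := N.carrier)) y
    have h' : (Limits.biprod.inl : M.carrier ⟶ M.carrier ⊞ N.carrier)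
          ((Limits.biprod.fst : M.carrier ⊞ N.carrier ⟶ _) y) +
        (Limits.biprod.inr : N.carrier ⟶ M.carrier ⊞ N.carrier)
          ((Limits.biprod.snd : M.carrier ⊞ N.carrier ⟶ _) y) = y := h
    constructor
    · intro hy
      have hy' : (Limits.biprod.snd : M.carrier ⊞ N.carrier ⟶ _) y = 0 := hy
      rw [hy', map_zero, add_zero] at h'
      exact ⟨_, h'⟩
    · rintro ⟨z, rfl⟩
      exact ConcreteCategory.congr_hom (Limits.biprod.inl_snd (X := M.carrier) (Y := N.carrier)) z
  surjective := (ModuleCat.epi_iff_surjective _).1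
    (inferInstanceAs (Epi (Limits.biprod.snd : M.carrier ⊞ N.carrier ⟶ N.carrier)))

end Extension

/-- `Ext¹(N, M)` in the category of `F_R`-modules, in the sense of Yoneda: equivalence classes of
extensions of `N` by `M`. -/
def Ext1 (N M : FRModule R p) : Type (u + 1) :=
  Quotient (Extension.setoid N M)

/-- The zero element of `Ext¹(N, M)` is the class of the split extension. -/
instance (N M : FRModule R p) : Zero (Ext1 N M) :=
  ⟨Quotient.mk _ (Extension.split N M)⟩

end FRModule

section GeneratingMorphism

variable {R : Type u} [CommRing R] {p : ℕ} [ExpChar R p]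

/-- The modules `F^e(M₀)`. -/
def frobIter (p : ℕ) [ExpChar R p] (M₀ : ModuleCat.{u} R) : ℕ → ModuleCat.{u} R
  | 0 => M₀
  | e + 1 => (frobeniusFunctor R p).obj (frobIter p M₀ e)

/-- The maps `F^e(β) : F^e(M₀) → F^{e+1}(M₀)`. -/
def frobIterMap {M₀ : ModuleCat.{u} R} (β : M₀ ⟶ (frobeniusFunctor R p).obj M₀) :
    (e : ℕ) → (frobIter p M₀ e ⟶ frobIter p M₀ (e + 1))
  | 0 => β
  | e + 1 => (frobeniusFunctor R p).map (frobIterMap β e)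

/-- The inductive system `M₀ → F(M₀) → F²(M₀) → ⋯` with transition maps `F^e(β)`. -/
def frobSystem {M₀ : ModuleCat.{u} R} (β : M₀ ⟶ (frobeniusFunctor R p).obj M₀) :
    ℕ ⥤ ModuleCat.{u} R :=
  Functor.ofSequence (frobIterMap β)

/-- `β : M₀ → F(M₀)` is a generating morphism of the `F_R`-module `M`: the module `M` is the direct
limit of `M₀ → F(M₀) → F²(M₀) → ⋯`, and `θ : M → F(M)` is induced by the vertical arrows
`F^e(β) : F^e(M₀) → F(F^e(M₀))`, where `F(M)` receives the maps obtained by applying `F` to the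
maps `F^e(M₀) → M`. -/
def FRModule.IsGeneratingMorphism {M₀ : ModuleCat.{u} R}
    (β : M₀ ⟶ (frobeniusFunctor R p).obj M₀) (M : FRModule R p) : Prop :=
  ∃ c : frobSystem β ⟶ (Functor.const ℕ).obj M.carrier,
    Nonempty (Limits.IsColimit (Limits.Cocone.mk M.carrier c)) ∧
    ∀ e : ℕ, c.app e ≫ M.str.hom = frobIterMap β e ≫ (frobeniusFunctor R p).map (c.app e)

end GeneratingMorphism

section InjectiveHull

/-- `E` is an injective hull of `M`: `E` is an injective module, and there is an injective linear
map `M → E` whose image meets every nonzero submodule of `E` nontrivially. -/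
def IsInjectiveHull (R : Type u) [CommRing R] (M E : Type u) [AddCommGroup M] [Module R M]
    [AddCommGroup E] [Module R E] : Prop :=
  Module.Injective R E ∧ ∃ i : M →ₗ[R] E, Function.Injective i ∧
    ∀ N : Submodule R E, N ≠ ⊥ → N ⊓ LinearMap.range i ≠ ⊥

end InjectiveHull

section Standard

variable {R : Type u} [CommRing R] [IsLocalRing R] (p : ℕ) [ExpChar R p]

/-- The linear map `R/I → N` that sends `1` to an element `n` of `N` killed by `I`. -/
def quotientLift {R : Type u} [CommRing R] (I : Ideal R) {N : ModuleCat.{u} R} (n : N)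
    (h : ∀ a ∈ I, a • n = 0) : ModuleCat.of R (R ⧸ I) ⟶ N :=
  ModuleCat.ofHom (Submodule.liftQ I (LinearMap.toSpanSingleton R N n) h)

theorem quotientLift_one {R : Type u} [CommRing R] (I : Ideal R) {N : ModuleCat.{u} R} (n : N)
    (h : ∀ a ∈ I, a • n = 0) : quotientLift I n h (1 : R ⧸ I) = n :=
  one_smul R n

/-- The element `x₁^(p-1) ⋯ x_d^(p-1) ⊗ 1` of `F(R/m)`. -/
def standardElement {d : ℕ} (x : Fin d → R) :
    (frobeniusFunctor R p).obj (ModuleCat.of R (R ⧸ maximalIdeal R)) :=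
  frobTmul p (M := ModuleCat.of R (R ⧸ maximalIdeal R))
    (∏ i, x i ^ (p - 1)) (1 : R ⧸ maximalIdeal R)

theorem smul_standardElement {d : ℕ} (x : Fin d → R)
    (hx : Ideal.span (Set.range x) = maximalIdeal R) (a : R) (ha : a ∈ maximalIdeal R) :
    a • standardElement p x = 0 := by
  rw [← hx] at ha
  induction ha using Submodule.span_induction with
  | mem a h =>
    obtain ⟨i, rfl⟩ := h
    have hxi : x i • (1 : R ⧸ maximalIdeal R) = 0 := by
      rw [Algebra.smul_def, mul_one]
      exact Ideal.Quotient.eq_zero_iff_mem.2 (hx ▸ Ideal.subset_span ⟨i, rfl⟩)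
    have hp : x i * ∏ j, x j ^ (p - 1) = x i ^ p * ∏ j ∈ Finset.univ.erase i, x j ^ (p - 1) := by
      rw [← Finset.mul_prod_erase _ _ (Finset.mem_univ i), ← mul_assoc, ← pow_succ',
        Nat.sub_add_cancel (expChar_pos R p)]
    rw [standardElement, smul_frobTmul, hp]
    exact (frobTmul_smul p (M := ModuleCat.of R (R ⧸ maximalIdeal R)) _ (x i) _).symm.trans
      ((congrArg _ hxi).trans (frobTmul_zero p _))
  | zero => exact zero_smul _ _
  | add a b _ _ h₁ h₂ => rw [add_smul, h₁, h₂, add_zero]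
  | smul a b _ h => rw [smul_assoc, h, smul_zero]

/-- For generators `x₁, …, x_d` of the maximal ideal `m`, the map `β : R/m → F(R/m)` that sends
`1` to the class of `x₁^(p-1) ⋯ x_d^(p-1)`, that is, to `x₁^(p-1) ⋯ x_d^(p-1) ⊗ 1`. -/
def standardGenerator {d : ℕ} (x : Fin d → R) (hx : Ideal.span (Set.range x) = maximalIdeal R) :
    ModuleCat.of R (R ⧸ maximalIdeal R) ⟶
      (frobeniusFunctor R p).obj (ModuleCat.of R (R ⧸ maximalIdeal R)) :=
  quotientLift (maximalIdeal R) (standardElement p x) (smul_standardElement p x hx)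

/-- The socle of a module over a local ring: the elements killed by the maximal ideal. -/
def socle (R : Type u) [CommRing R] [IsLocalRing R] (M : Type u) [AddCommGroup M] [Module R M] :
    Submodule R M :=
  Submodule.torsionBySet R M (maximalIdeal R)

end Standard
end

/-! Write `π = ∏ xᵢ^(p-1)`. The image `s` of `1` under `R/m → E` is a nonzero socle element with `π
s^p = s`, and every element of `E` is killed by a power of `m`. Suppose `w = y^p - y` lies in the
socle and `y ≠ 0`. Let `m^(n+1)` be the first power killing `y`. It also kills `w`, hence `y^p`.
Some `a ∈ m^n` has `a y` nonzero in the socle, which is one-dimensional, so `r a y = s`. Then `s = π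
s^p = r^p (π a^p) y^p = 0`, because `π a^p ∈ m^(n+1)`: a contradiction. So the socle meets `G_E`
only in `0` (`eq_zero_of_mem_socle_of_mem_G`). Each `w ∈ E` gives an extension of `R` by `E` in
which a lift `e` of `1` satisfies `e^p = w + e`. Equivalent extensions have parameters congruent
modulo `G_E` (`sub_mem_G_of_equiv`), so the socle embeds in `Ext¹`. If `E` were injective, all
parameters would lie in `G_E` (`mem_G_of_injective`). -/

section FrobeniusAction

/-! ### The `p`-th power map on `F_R`-modules -/

variable {R : Type u} [CommRing R] {p : ℕ} [ExpChar R p]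

theorem frobeniusFunctor_induction {M : ModuleCat.{u} R}
    {motive : (frobeniusFunctor R p).obj M → Prop} (z : (frobeniusFunctor R p).obj M)
    (zero : motive 0) (tmul : ∀ (r : R) (y : M), motive (frobTmul p r y))
    (add : ∀ y z, motive y → motive z → motive (y + z)) : motive z := by
  let := Module.compHom (FrobRing R) (frobMap R p)
  induction z using TensorProduct.induction_on with
  | zero => exact zero
  | tmul r y => exact tmul r y
  | add y z hy hz => exact add y z hy hz

/-- On pure tensors `a^p (r ⊗ y) = r ⊗ a y`. -/
theorem pow_smul_frobeniusFunctor_eq_zero {M : ModuleCat.{u} R} {a : R}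
    (h : ∀ y : M, a • y = 0) (z : (frobeniusFunctor R p).obj M) : a ^ p • z = 0 := by
  refine frobeniusFunctor_induction (motive := fun z => a ^ p • z = 0) z (smul_zero _)
    (fun r y => ?_) fun y z hy hz => ?_
  · rw [smul_frobTmul, ← frobTmul_smul, h, frobTmul_zero]
  · rw [smul_add, hy, hz, add_zero]

theorem pow_smul_frobIter_eq_zero {M₀ : ModuleCat.{u} R} {a : R}
    (h : ∀ y : M₀, a • y = 0) (e : ℕ) (z : frobIter p M₀ e) : a ^ p ^ e • z = 0 := by
  induction e with
  | zero => rw [pow_zero, pow_one]; exact h z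
  | succ e ih => rw [pow_succ, pow_mul]; exact pow_smul_frobeniusFunctor_eq_zero ih z

namespace FRModule

variable {M N : FRModule R p}

theorem frob_apply (y : M.carrier) : M.frob y = M.str.inv (frobTmul p 1 y) := rfl

theorem frob_smul (r : R) (y : M.carrier) : M.frob (r • y) = r ^ p • M.frob y := by
  rw [frob_apply, frob_apply, ← map_smul, smul_frobTmul, frobTmul_smul]

/-- Compatibility with `θ` in the form used on elements: homomorphisms commute with `p`-th powers.
-/
theorem hom_frob (g : M ⟶ N) (y : M.carrier) : g.hom (M.frob y) = N.frob (g.hom y) := by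
  have h := ConcreteCategory.congr_hom g.comm (M.frob y)
  rw [ConcreteCategory.comp_apply, ConcreteCategory.comp_apply, frob_apply,
    ← ConcreteCategory.comp_apply M.str.inv, Iso.inv_hom_id, ConcreteCategory.id_apply,
    map_frobTmul] at h
  exact (ConcreteCategory.congr_hom N.str.hom_inv_id _).symm.trans (congrArg N.str.inv h.symm)

theorem mem_G {y : M.carrier} : y ∈ M.G ↔ ∃ z, M.frob z - z = y := Iff.rfl

variable (R p) in
theorem ring_frob_one : (ring R p).frob (1 : R) = (1 : R) :=
  ConcreteCategory.congr_hom (ring R p).str.hom_inv_id (1 : R)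

theorem mono_of_injective (g : M ⟶ N) (hg : Function.Injective g.hom) : Mono g := by
  have : Mono g.hom := (ModuleCat.mono_iff_injective _).2 hg
  exact ⟨fun a b hab => hom_ext ((cancel_mono g.hom).1 (congrArg Hom.hom hab))⟩

end FRModule

end FrobeniusAction

namespace FRModule

variable {R : Type u} [CommRing R] {p : ℕ} [ExpChar R p]

/-! ### Extensions obtained by shearing the direct sum -/

section Twist

variable {M N : FRModule R p}

/-- The inclusion `N → M ⊕ N`. -/
noncomputable def biprodInr (M N : FRModule R p) : N ⟶ biprod M N :=
  Hom.mk Limits.biprod.inr (by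
    change N.str.hom ≫ _ = Limits.biprod.inr ≫ Limits.biprod.map _ _ ≫
      ((frobeniusFunctor R p).mapBiprod M.carrier N.carrier).inv
    rw [Functor.mapBiprod_inv, Limits.biprod.inr_map_assoc]
    exact congrArg (N.str.hom ≫ ·) (Limits.biprod.inr_desc _ _).symm)

/-- The module `M ⊕ N` with its structure morphism composed with the shear of an `R`-linear map
`h : N → M`, so that `(m, n)^p = (m^p + h(n^p), n^p)`. -/
noncomputable def twistedBiprod (h : N.carrier ⟶ M.carrier) : FRModule R p where
  carrier := M.carrier ⊞ N.carrier
  str := (Biprod.unipotentLower h).symm ≪≫ (biprod M N).str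

/-- The extension of `N` by `M` with middle term `twistedBiprod h`. -/
noncomputable def twistedExtension (h : N.carrier ⟶ M.carrier) : Extension N M where
  L := twistedBiprod h
  i := Hom.mk Limits.biprod.inl (by
    -- The inverse shear fixes `M` pointwise and induces the identity on `N`, so the maps of the
    -- split extension still respect the structure.
    have e : Limits.biprod.inl ≫ (Biprod.unipotentLower h).inv = Limits.biprod.inl := by
      ext; simp [Biprod.unipotentLower]
    exact (biprodInl M N).comm.trans (congrArg (· ≫ (biprod M N).str.hom) e.symm))
  q := Hom.mk Limits.biprod.snd (by
    have e : (Biprod.unipotentLower h).inv ≫ Limits.biprod.snd = Limits.biprod.snd := by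
      ext; simp [Biprod.unipotentLower]
    exact (congrArg ((Biprod.unipotentLower h).inv ≫ ·) (biprodSnd M N).comm).trans
      (congrArg (· ≫ N.str.hom) e))
  -- Exactness concerns only the underlying modules, which the twist leaves unchanged.
  injective := (Extension.split N M).injective
  exact := (Extension.split N M).exact
  surjective := (Extension.split N M).surjective

/-- The `R`-linear inclusion of `N` into the middle term of the twisted extension. -/
noncomputable def twistedInr (h : N.carrier ⟶ M.carrier) : N.carrier ⟶ (twistedExtension h).L.carrier :=
  (Limits.biprod.inr : N.carrier ⟶ M.carrier ⊞ N.carrier)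

/-- The inverse of the twisted structure map is that of the direct sum followed by the shear. -/
theorem twistedExtension_frob_inr (h : N.carrier ⟶ M.carrier) (n : N.carrier) :
    (twistedExtension h).L.frob (twistedInr h n) =
      (twistedExtension h).i.hom (h (N.frob n)) + twistedInr h (N.frob n) := by
  have e : Limits.biprod.inr ≫ (Biprod.unipotentLower h).hom =
      h ≫ Limits.biprod.inl + Limits.biprod.inr := by
    ext; simp [Biprod.unipotentLower]
  have e' := ConcreteCategory.congr_hom e (N.frob n)
  refine Eq.trans ?_ e'
  exact congrArg (Biprod.unipotentLower h).hom (hom_frob (biprodInr M N) n).symm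

theorem twistedExtension_q_inr (h : N.carrier ⟶ M.carrier) (n : N.carrier) :
    (twistedExtension h).q.hom (twistedInr h n) = n :=
  ConcreteCategory.congr_hom (Limits.biprod.inr_snd (X := M.carrier) (Y := N.carrier)) n

end Twist

/-! ### Extensions of `R` by `E` and the quotient `E / G_E` -/

section ExtRing

variable {E : FRModule R p}

/-- The extension of `R` by `E` in which `1 ∈ R` lifts to an element with `(0, 1)^p = (w, 1)`. -/
noncomputable def extensionOf (w : E.carrier) : Extension (ring R p) E :=
  twistedExtension (N := ring R p) (ModuleCat.ofHom (LinearMap.toSpanSingleton R E.carrier w))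

/-- The standard lift of `1 ∈ R` to the middle term of `extensionOf w`. -/
noncomputable def liftOne (w : E.carrier) : (extensionOf w).L.carrier :=
  twistedInr (N := ring R p) _ (1 : R)

theorem frob_liftOne (w : E.carrier) :
    (extensionOf w).L.frob (liftOne w) = (extensionOf w).i.hom w + liftOne w := by
  have h := twistedExtension_frob_inr (N := ring R p)
    (ModuleCat.ofHom (LinearMap.toSpanSingleton R E.carrier w)) (1 : R)
  rw [ring_frob_one] at h
  have h1 : ModuleCat.ofHom (LinearMap.toSpanSingleton R E.carrier w) (1 : R) = w := one_smul R w
  exact h.trans (congrArg (fun v => (extensionOf w).i.hom v + liftOne w) h1)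

theorem q_liftOne (w : E.carrier) : (extensionOf w).q.hom (liftOne w) = (1 : R) :=
  twistedExtension_q_inr (N := ring R p) _ (1 : R)

/-- An equivalence sends the lift of `1` to the other lift plus some `t ∈ E`. Comparing `p`-th
powers gives `v + t = t^p + w`. -/
theorem sub_mem_G_of_equiv {v w : E.carrier} (h : extensionOf v ≈ extensionOf w) :
    v - w ∈ E.G := by
  obtain ⟨g, h₁, h₂⟩ := h
  have hi (y : E.carrier) : g.hom.hom ((extensionOf v).i.hom y) = (extensionOf w).i.hom y :=
    ConcreteCategory.congr_hom (congrArg Hom.hom h₁) y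
  have hq (y : (extensionOf v).L.carrier) :
      (extensionOf w).q.hom (g.hom.hom y) = (extensionOf v).q.hom y :=
    ConcreteCategory.congr_hom (congrArg Hom.hom h₂) y
  obtain ⟨t, ht⟩ := ((extensionOf w).exact (g.hom.hom (liftOne v) - liftOne w)).1 (by
    rw [map_sub, hq, q_liftOne, q_liftOne]
    exact sub_self (1 : R))
  rw [eq_sub_iff_add_eq] at ht
  have key := hom_frob g.hom (liftOne v)
  rw [frob_liftOne, map_add, hi, ← ht, map_add, ← hom_frob, frob_liftOne, ← add_assoc,
    ← add_assoc, add_left_inj, ← map_add, ← map_add] at key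
  refine mem_G.2 ⟨t, ?_⟩
  rw [sub_eq_sub_iff_add_eq_add, ← (extensionOf w).injective key]

/-- A retraction onto `E` sends the lift of `1` to some `t` with `t^p = w + t`. -/
theorem mem_G_of_injective [Injective E] (w : E.carrier) : w ∈ E.G := by
  have := mono_of_injective (extensionOf w).i (extensionOf w).injective
  have hi (y : E.carrier) :
      (Injective.factorThru (𝟙 E) (extensionOf w).i).hom ((extensionOf w).i.hom y) = y :=
    ConcreteCategory.congr_hom
      (congrArg Hom.hom (Injective.comp_factorThru (𝟙 E) (extensionOf w).i)) y
  have key := hom_frob (Injective.factorThru (𝟙 E) (extensionOf w).i) (liftOne w)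
  rw [frob_liftOne, map_add, hi] at key
  exact mem_G.2 ⟨_, (eq_sub_of_add_eq key).symm⟩

end ExtRing

end FRModule

/-! ### The socle and the Frobenius action on the standard module -/

section Standard

variable {R : Type u} [CommRing R] {p : ℕ} [ExpChar R p]

/-- By essentiality every nonzero socle element has a multiple equal to `i 1`. For `v` the
multiplier is a unit, since a nonunit would kill `v`, so the relation can be inverted. -/
theorem IsInjectiveHull.exists_smul_eq_of_mem_socle [IsLocalRing R] {E : Type u}
    [AddCommGroup E] [Module R E] (hE : IsInjectiveHull R (R ⧸ maximalIdeal R) E)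
    {u v : E} (hu : u ∈ socle R E) (hu0 : u ≠ 0) (hv : v ∈ socle R E) :
    ∃ r : R, r • u = v := by
  obtain ⟨-, i, hi, hess⟩ := hE
  have main {u : E} (hu : u ∈ socle R E) (hu0 : u ≠ 0) : ∃ r : R, r • u = i 1 := by
    obtain ⟨z, hz, hz0⟩ := Submodule.exists_mem_ne_zero_of_ne_bot
      (hess (R ∙ u) (by simpa using hu0))
    obtain ⟨hz1, k, hk⟩ := hz
    obtain ⟨r, rfl⟩ := Submodule.mem_span_singleton.1 hz1
    have hk0 : k ≠ 0 := by rintro rfl; exact hz0 (by rw [← hk, map_zero])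
    obtain ⟨a, rfl⟩ := Ideal.Quotient.mk_surjective k
    have ha : IsUnit a := by
      by_contra h
      exact hk0 (Ideal.Quotient.eq_zero_iff_mem.2 ((mem_maximalIdeal a).2 h))
    obtain ⟨b, hb⟩ := ha.exists_left_inv
    refine ⟨b * r, ?_⟩
    rw [mul_smul, ← hk, ← map_smul]
    congr 1
    rw [Algebra.smul_def]
    change Ideal.Quotient.mk _ b * Ideal.Quotient.mk _ a = 1
    rw [← map_mul, hb, map_one]
  obtain ⟨r, hr⟩ := main hu hu0
  by_cases hv0 : v = 0
  · exact ⟨0, by rw [hv0, zero_smul]⟩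
  obtain ⟨s, hs⟩ := main hv hv0
  have hsu : IsUnit s := by
    by_contra h
    have h0 : s • v = 0 := (Submodule.mem_torsionBySet_iff _ _).1 hv ⟨s, (mem_maximalIdeal s).2 h⟩
    have : (1 : R ⧸ maximalIdeal R) = 0 := hi (by rw [← hs, h0, map_zero])
    exact one_ne_zero this
  obtain ⟨b, hb⟩ := hsu.exists_left_inv
  exact ⟨b * r, by rw [mul_smul, hr, ← hs, ← mul_smul, hb, one_smul]⟩

/-- Apply `F` to the cocone relation at stage `e`. This lets vanishing of one colimit map pass to
the next. -/
theorem FRModule.map_colimit_map {M₀ : ModuleCat.{u} R}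
    {β : M₀ ⟶ (frobeniusFunctor R p).obj M₀} {M : FRModule R p}
    {c : frobSystem β ⟶ (Functor.const ℕ).obj M.carrier}
    (hc : ∀ e : ℕ, c.app e ≫ M.str.hom = frobIterMap β e ≫ (frobeniusFunctor R p).map (c.app e))
    (e : ℕ) : c.app (e + 1) ≫ M.str.hom = (frobeniusFunctor R p).map (c.app e) := by
  have hn : frobIterMap β e ≫ c.app (e + 1) = c.app e := by
    have := c.naturality (homOfLE (Nat.le_add_right e 1))
    exact (congrArg (· ≫ c.app (e + 1))
      (Functor.ofSequence_map_homOfLE_succ (frobIterMap β) e)).symm.trans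
      (this.trans (Category.comp_id _))
  rw [hc]
  exact ((frobeniusFunctor R p).map_comp _ _).symm.trans
    (congrArg (frobeniusFunctor R p).map hn)

/-- The properties of the Frobenius action on the standard module `E` used for the structure of
`E / G_E`. -/
theorem FRModule.IsGeneratingMorphism.exists_generator [IsLocalRing R] {d : ℕ} {x : Fin d → R}
    {hx : Ideal.span (Set.range x) = maximalIdeal R} {E : FRModule R p} [Nontrivial E.carrier]
    (hstd : E.IsGeneratingMorphism (standardGenerator p x hx)) :
    (∃ s ∈ socle R E.carrier, s ≠ 0 ∧ (∏ i, x i ^ (p - 1)) • E.frob s = s) ∧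
      ∀ y : E.carrier, ∃ n : ℕ, ∀ a ∈ maximalIdeal R ^ n, a • y = 0 := by
  obtain ⟨c, ⟨hcol⟩, hc⟩ := hstd
  have hmap := map_colimit_map hc
  have hkill (a : R) (ha : a ∈ maximalIdeal R) (z : R ⧸ maximalIdeal R) : a • z = 0 := by
    rw [Algebra.smul_def]
    exact mul_eq_zero_of_left (Ideal.Quotient.eq_zero_iff_mem.2 ha) z
  -- Stage `0` of the compatibility says `θ(s) = π ⊗ s` for `s` the image of `1`; apply `θ⁻¹`.
  have hfrob : (∏ i, x i ^ (p - 1)) • E.frob (c.app 0 (1 : R ⧸ maximalIdeal R)) =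
      c.app 0 (1 : R ⧸ maximalIdeal R) := by
    have h := ConcreteCategory.congr_hom (hc 0) (1 : R ⧸ maximalIdeal R)
    have h1 : E.str.hom (c.app 0 (1 : R ⧸ maximalIdeal R)) =
        frobTmul p (∏ i, x i ^ (p - 1)) (c.app 0 (1 : R ⧸ maximalIdeal R)) := by
      refine h.trans ?_
      refine (congrArg ((frobeniusFunctor R p).map (c.app 0))
        (quotientLift_one (maximalIdeal R) _ (smul_standardElement p x hx))).trans ?_
      exact map_frobTmul p (c.app 0) _ _
    rw [frob_apply, ← map_smul, smul_frobTmul, mul_one, ← h1]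
    exact ConcreteCategory.congr_hom E.str.hom_inv_id (c.app 0 (1 : R ⧸ maximalIdeal R))
  refine ⟨⟨c.app 0 (1 : R ⧸ maximalIdeal R), ?_, ?_, hfrob⟩, fun y => ?_⟩
  · refine (Submodule.mem_torsionBySet_iff _ _).2 fun a => ?_
    refine (map_smul (c.app 0).hom (a : R) (1 : R ⧸ maximalIdeal R)).symm.trans ?_
    exact (congrArg (c.app 0).hom (hkill a a.2 1)).trans (map_zero _)
  · intro h0
    -- If `s = 0`, all maps into the colimit vanish, forcing `E = 0`.
    have hzero (e : ℕ) : c.app e = 0 := by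
      induction e with
      | zero =>
        refine ModuleCat.hom_ext (LinearMap.ext fun z => ?_)
        obtain ⟨r, rfl⟩ := Ideal.Quotient.mk_surjective (I := maximalIdeal R) z
        have hr : Ideal.Quotient.mk (maximalIdeal R) r = r • (1 : R ⧸ maximalIdeal R) := by
          rw [Algebra.smul_def, mul_one]; rfl
        refine (congrArg (c.app 0).hom hr).trans ?_
        refine (map_smul (c.app 0).hom r (1 : R ⧸ maximalIdeal R)).trans ?_
        exact (congrArg (r • ·) h0).trans (smul_zero r)
      | succ e ih =>
        rw [← cancel_mono E.str.hom, hmap, ih, Limits.zero_comp]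
        exact (frobeniusFunctor R p).map_zero _ _
    have hid : 𝟙 E.carrier = 0 := hcol.hom_ext fun e => by
      change c.app e ≫ _ = c.app e ≫ _
      rw [hzero e, Limits.zero_comp, Limits.zero_comp]
    obtain ⟨y, hy⟩ := exists_ne (0 : E.carrier)
    exact hy (ConcreteCategory.congr_hom hid y)
  · have : Limits.PreservesFilteredColimitsOfSize.{0, 0} (forget (ModuleCat.{u} R)) :=
      Limits.preservesFilteredColimitsOfSize_shrink.{0, u, 0, u} _
    obtain ⟨e, z, rfl⟩ := Limits.Concrete.isColimit_exists_rep _ hcol y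
    have hz (i : Fin d) : x i ^ p ^ e • c.app e z = 0 := by
      refine (map_smul (c.app e).hom (x i ^ p ^ e) z).symm.trans ?_
      refine (congrArg (c.app e).hom ?_).trans (map_zero _)
      exact pow_smul_frobIter_eq_zero
        (hkill (x i) (hx ▸ Ideal.subset_span ⟨i, rfl⟩)) e z
    let J : Ideal R := (LinearMap.toSpanSingleton R E.carrier (c.app e z)).ker
    -- The annihilator `J` contains each `xᵢ^(p^e)`, as `xᵢ` kills `R/m`; finite generation then
    -- puts a power of `m` inside `J`.
    have hrad : maximalIdeal R ≤ J.radical := by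
      rw [← hx, Ideal.span_le]
      rintro _ ⟨i, rfl⟩
      exact ⟨p ^ e, hz i⟩
    obtain ⟨n, hn⟩ := Ideal.exists_pow_le_of_le_radical_of_fg hrad
      (hx.symm ▸ Submodule.fg_span (Set.finite_range x) : (maximalIdeal R).FG)
    exact ⟨n, fun a ha => hn ha⟩

theorem FRModule.eq_zero_of_mem_socle_of_mem_G [IsLocalRing R] (hp : 2 ≤ p)
    {d : ℕ} (hd : 1 ≤ d) {x : Fin d → R}
    (hx : Ideal.span (Set.range x) = maximalIdeal R) {E : FRModule R p}
    (hE : IsInjectiveHull R (R ⧸ maximalIdeal R) E.carrier)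
    {s : E.carrier} (hs : s ∈ socle R E.carrier) (hs0 : s ≠ 0)
    (hfrob : (∏ i, x i ^ (p - 1)) • E.frob s = s)
    (htors : ∀ y : E.carrier, ∃ n : ℕ, ∀ a ∈ maximalIdeal R ^ n, a • y = 0)
    {w : E.carrier} (hw : w ∈ socle R E.carrier) (hwG : w ∈ E.G) : w = 0 := by
  classical
  obtain ⟨y, rfl⟩ := mem_G.1 hwG
  by_cases hy : y = 0
  · rw [hy, map_zero, sub_zero]
  exfalso
  obtain ⟨n, hn, hmin⟩ : ∃ n, (∀ a ∈ maximalIdeal R ^ (n + 1), a • y = 0) ∧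
      ∃ a ∈ maximalIdeal R ^ n, a • y ≠ 0 := by
    -- `m^0 = R` kills only `0`, so the least exponent has the form `n + 1`.
    have h0 : Nat.find (htors y) ≠ 0 := fun h => hy (by
      have := Nat.find_spec (htors y) 1 (by rw [h, pow_zero, Ideal.one_eq_top]; trivial)
      rwa [one_smul] at this)
    obtain ⟨n, hn⟩ := Nat.exists_eq_succ_of_ne_zero h0
    refine ⟨n, fun a ha => Nat.find_spec (htors y) a (by rwa [hn]), ?_⟩
    have := Nat.find_min (htors y) (m := n) (by omega)
    push Not at this
    exact this
  obtain ⟨a, ha, hay⟩ := hmin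
  have hsoc : a • y ∈ socle R E.carrier := by
    refine (Submodule.mem_torsionBySet_iff _ _).2 fun b => ?_
    rw [← smul_assoc]
    exact hn _ (by rw [pow_succ', smul_eq_mul]; exact Ideal.mul_mem_mul b.2 ha)
  obtain ⟨r, hr⟩ := hE.exists_smul_eq_of_mem_socle hsoc hay hs
  have hxi (i : Fin d) : x i ∈ maximalIdeal R := hx ▸ Ideal.subset_span ⟨i, rfl⟩
  have hprod : ∏ i, x i ^ (p - 1) ∈ maximalIdeal R :=
    Ideal.mem_of_dvd _ (Finset.dvd_prod_of_mem _ (Finset.mem_univ ⟨0, hd⟩))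
      (Ideal.pow_mem_of_mem _ (hxi _) _ (by omega))
  -- The extra factor of `m` comes from `π`, which lies in `m` because `d ≥ 1` and `p ≥ 2`.
  have hmem : (∏ i, x i ^ (p - 1)) * a ^ p ∈ maximalIdeal R ^ (n + 1) := by
    rw [pow_succ']
    refine Ideal.mul_mem_mul hprod ?_
    exact Ideal.pow_mem_of_mem _ ha _ (by omega)
  -- Since `n + 1 ≥ 1`, `m^(n+1)` kills the socle element `y^p - y` as well as `y`.
  have hkill (b : R) (hb : b ∈ maximalIdeal R ^ (n + 1)) : b • E.frob y = 0 := by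
    have h1 : b • (E.frob y - y) = 0 := (Submodule.mem_torsionBySet_iff _ _).1 hw
      ⟨b, Ideal.pow_le_self (Nat.succ_ne_zero n) hb⟩
    rwa [smul_sub, hn b hb, sub_zero] at h1
  apply hs0
  rw [← hfrob, ← hr, frob_smul, frob_smul, smul_comm, ← mul_smul _ (a ^ p), hkill _ hmem,
    smul_zero]

theorem infinite_socle [IsLocalRing R] [Infinite (ResidueField R)] {E : Type u}
    [AddCommGroup E] [Module R E] (hE : IsInjectiveHull R (R ⧸ maximalIdeal R) E) :
    Infinite (socle R E) := by
  obtain ⟨-, i, hi, -⟩ := hE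
  have : Infinite (R ⧸ maximalIdeal R) := ‹Infinite (ResidueField R)›
  have hmem (z : R ⧸ maximalIdeal R) : i z ∈ socle R E := by
    refine (Submodule.mem_torsionBySet_iff _ _).2 fun a => ?_
    rw [← map_smul, Algebra.smul_def]
    exact (congrArg i (mul_eq_zero_of_left (Ideal.Quotient.eq_zero_iff_mem.2 a.2) z)).trans
      (map_zero i)
  exact Infinite.of_injective (fun z => (⟨i z, hmem z⟩ : socle R E))
    fun a b h => hi (congrArg Subtype.val h)

end Standard

theorem mainTheorem6 (R : Type u) [CommRing R] [IsRegularLocalRing R]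
    (p : ℕ) [Fact p.Prime] [CharP R p]
    (d : ℕ) (hd : 1 ≤ d) (hdim : ringKrullDim R = d)
    (x : Fin d → R) (hx : Ideal.span (Set.range x) = maximalIdeal R)
    (E : FRModule R p) (hE : IsInjectiveHull R (R ⧸ maximalIdeal R) E.carrier)
    (hstd : E.IsGeneratingMorphism (standardGenerator p x hx)) :
    Set.InjOn (QuotientAddGroup.mk : E.carrier → E.carrier ⧸ E.G) (socle R E.carrier) ∧
    (∃ ξ : FRModule.Ext1 (FRModule.ring R p) E, ξ ≠ 0) ∧
    (Infinite (ResidueField R) → Infinite (FRModule.Ext1 (FRModule.ring R p) E)) ∧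
    ¬ CategoryTheory.Injective E := by
  have : Nontrivial E.carrier := by
    obtain ⟨-, i, hi, -⟩ := hE
    exact hi.nontrivial
  obtain ⟨⟨s, hs, hs0, hfrob⟩, htors⟩ := hstd.exists_generator
  have hzero {w : E.carrier} (hw : w ∈ socle R E.carrier) (hwG : w ∈ E.G) : w = 0 :=
    FRModule.eq_zero_of_mem_socle_of_mem_G (Fact.out : p.Prime).two_le hd hx hE hs hs0 hfrob
      htors hw hwG
  have hinj : Function.Injective fun u : socle R E.carrier =>
      (Quotient.mk _ (FRModule.extensionOf u.1) : FRModule.Ext1 (FRModule.ring R p) E) :=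
    fun u v huv => Subtype.ext (sub_eq_zero.1 (hzero (Submodule.sub_mem _ u.2 v.2)
      (FRModule.sub_mem_G_of_equiv (Quotient.exact huv))))
  refine ⟨fun u hu v hv huv => ?_, ?_, fun _ => ?_, fun _ => ?_⟩
  -- Equality of cosets is expressed through `-u + v`, again a socle element.
  · have h : -u + v ∈ E.G := QuotientAddGroup.eq.1 huv
    exact (neg_add_eq_zero.1 (hzero (Submodule.add_mem _ (Submodule.neg_mem _ hu) hv) h))
  · have : Nontrivial (socle R E.carrier) := ⟨⟨s, hs⟩, 0, fun h => hs0 (congrArg Subtype.val h)⟩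
    have : Nontrivial (FRModule.Ext1 (FRModule.ring R p) E) := hinj.nontrivial
    exact exists_ne 0
  · have := infinite_socle hE
    exact Infinite.of_injective _ hinj
  · exact hs0 (hzero hs (FRModule.mem_G_of_injective s))
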